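/- Let $V$ be a Hermitian vector space of dimension $M<\infty$, let $U(x)$, $x\in\mathbb{R}$, be a family of unitary operators on $V$ depending real analytically on $x$, and let $D(x)=\frac1i U'(x)U(x)^{-1}$ (a symmetric operator). Suppose that $U$ is monotone, i.e. that $D(x)$ is positive definite for every $x\in\mathbb{R}$. Put $W(x)=\ker(I-U(x))$ and $\mathcal{Z}=\{x\in\mathbb{R}: W(x)\neq\{0\}\}$. Then $\mathcal{Z}$ is a discrete subset of $\mathbb{R}$. More precisely, for all $A<B$ the set $\mathcal{Z}\cap(A,B)$ is finite, and $$\left|\sum_{x:\,A<x<B}\dim W(x)-\frac1{2\pi}\int_A^B \operatorname{tr}D(x)\,dx\right|< M,$$ except when $U(A)=U(B)=I$; in this exceptional case the inequality holds with $\le$ in place of $<$. -/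

import Mathlib

noncomputable section

namespace UnitaryFamily

variable {V : Type*} [NormedAddCommGroup V] [InnerProductSpace ℂ V]

/-- The unitary `U x` as a bounded operator on `V`. -/
def op (U : ℝ → V ≃ₗᵢ[ℂ] V) (x : ℝ) : V →L[ℂ] V :=
  ((U x).toContinuousLinearEquiv : V →L[ℂ] V)

/-- `U` depends real analytically on `x ∈ ℝ` (with respect to the operator norm). -/
def IsAnalytic (U : ℝ → V ≃ₗᵢ[ℂ] V) : Prop :=
  AnalyticOnNhd ℝ (op U) Set.univ

/-- `D(x) = (1/i) U'(x) U(x)⁻¹`. -/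
def D (U : ℝ → V ≃ₗᵢ[ℂ] V) (x : ℝ) : V →L[ℂ] V :=
  (1 / Complex.I) • (deriv (op U) x ∘L ((U x)⁻¹).toContinuousLinearEquiv)

/-- `D(x)` is positive definite for every `x`. (`D(x)` is automatically symmetric for a
differentiable `U`, so the real part is only there to make the inequality one in `ℝ`.) -/
def IsMonotone (U : ℝ → V ≃ₗᵢ[ℂ] V) : Prop :=
  ∀ x : ℝ, ∀ v : V, v ≠ 0 → 0 < (inner ℂ (D U x v) v).re

/-- `W(x) = ker (I - U(x))`. -/
def W (U : ℝ → V ≃ₗᵢ[ℂ] V) (x : ℝ) : Submodule ℂ V :=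
  LinearMap.ker (ContinuousLinearMap.id ℂ V - op U x).toLinearMap

/-- `𝒵 = {x : W(x) ≠ {0}}`. -/
def Z (U : ℝ → V ≃ₗᵢ[ℂ] V) : Set ℝ :=
  {x | W U x ≠ ⊥}

end UnitaryFamily

end

/-! The eigenvalues of `U x` lie on the unit circle, and monotonicity makes those near 1 move
counterclockwise. Let `phaseNonneg` and `phasePos` be the sums of their arguments in [0, 2π) and (0,
2π]. Both are arguments of det U, and they differ by 2π dim W. By Jacobi's formula ∫ tr D is also a
continuous argument of det U, up to a constant (`det_eq_mul_exp`). Hence ∫ tr D − `phaseNonneg`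
takes values in one coset of 2πℤ. It is right-continuous, so locally constant to the right, and on
arriving at x from the left it jumps by 2π dim W(x). Summing the jumps (`sum_jumps_eq`) gives the
exact identity `finsum_finrank_W`: 2π Σ dim W − ∫ tr D = `phaseNonneg U A` − `phasePos U B`. The two
phases lie in [0, 2πM) and (0, 2πM] when M > 0, and the extreme value −2πM forces U(A) = U(B) = I.
-/

open Filter Topology

/-! ### Differentiating the determinant -/

section Det

variable {V : Type*} [NormedAddCommGroup V] [NormedSpace ℂ V] [FiniteDimensional ℂ V]

theorem ContinuousLinearMap.differentiable_det_complex :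
    Differentiable ℂ (fun f : V →L[ℂ] V => LinearMap.det f.toLinearMap) := by
  let b := Module.finBasis ℂ V
  have key : (fun f : V →L[ℂ] V => LinearMap.det f.toLinearMap) = fun f =>
      ∑ σ : Equiv.Perm (Fin (Module.finrank ℂ V)), Equiv.Perm.sign σ •
        ∏ i, (LinearMap.toContinuousLinearMap (b.coord (σ i))) (f (b i)) := by
    ext f
    rw [← LinearMap.det_toMatrix b, Matrix.det_apply]
    simp [LinearMap.toMatrix_apply]
  rw [key]
  simp only [Units.smul_def, zsmul_eq_mul]
  refine Differentiable.fun_sum fun σ _ => Differentiable.const_mul ?_ _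
  intro f
  exact (HasFDerivAt.finsetProd (𝕜 := ℂ) (u := Finset.univ)
    (g := fun i (f : V →L[ℂ] V) => (LinearMap.toContinuousLinearMap (b.coord (σ i))) (f (b i)))
    fun i _ => DifferentiableAt.hasFDerivAt (by fun_prop)).differentiableAt.congr_of_eventuallyEq
      (Eventually.of_forall fun f => by simp)

theorem LinearMap.det_one_add_smul_eq (f : V →ₗ[ℂ] V) :
    ∃ p : Polynomial ℂ, ∀ t : ℂ,
      LinearMap.det (1 + t • f) = 1 + LinearMap.trace ℂ V f * t + p.eval t * t ^ 2 := by
  let b := Module.finBasis ℂ V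
  have h (t : ℂ) := Matrix.det_one_add_smul t (LinearMap.toMatrix b b f)
  simp_rw [← LinearMap.toMatrix_one b, ← map_smul, ← map_add, LinearMap.det_toMatrix,
    ← LinearMap.trace_eq_matrix_trace ℂ b] at h
  exact ⟨_, h⟩

theorem ContinuousLinearMap.hasFDerivAt_det_one :
    ∃ L : (V →L[ℂ] V) →L[ℂ] ℂ,
      HasFDerivAt (fun f : V →L[ℂ] V => LinearMap.det f.toLinearMap) L 1 ∧
      ∀ f, L f = LinearMap.trace ℂ V f.toLinearMap := by
  have h1 := (ContinuousLinearMap.differentiable_det_complex (V := V) 1).hasFDerivAt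
  refine ⟨_, h1, fun f => ?_⟩
  obtain ⟨p, hp⟩ := LinearMap.det_one_add_smul_eq f.toLinearMap
  have hline : HasDerivAt (fun t : ℂ => (1 : V →L[ℂ] V) + t • f) f 0 := by
    simpa using ((hasDerivAt_id (0 : ℂ)).smul_const f).const_add 1
  have h2 := HasFDerivAt.comp_hasDerivAt (0 : ℂ) (by simpa using h1) hline
  have h3 : HasDerivAt (fun t : ℂ => 1 + LinearMap.trace ℂ V f.toLinearMap * t
      + p.eval t * t ^ 2) (LinearMap.trace ℂ V f.toLinearMap) 0 := by
    have := (((hasDerivAt_id (0 : ℂ)).const_mul (LinearMap.trace ℂ V f.toLinearMap)).const_add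
      1).add ((p.hasDerivAt 0).mul ((hasDerivAt_id (0 : ℂ)).pow 2))
    refine (this.congr_deriv (by simp)).congr_of_eventuallyEq (Eventually.of_forall fun t => ?_)
    simp
  refine h2.unique (h3.congr_of_eventuallyEq (Eventually.of_forall fun t => ?_))
  simpa using hp t

/-- Jacobi's formula for the derivative of the determinant along a curve. -/
theorem HasDerivAt.linearMap_det {u : ℝ → V →L[ℂ] V} {u' e : V →L[ℂ] V} {x : ℝ}
    (h : HasDerivAt u u' x) (he : u x * e = 1) :
    HasDerivAt (fun y => LinearMap.det (u y).toLinearMap)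
      (LinearMap.det (u x).toLinearMap * LinearMap.trace ℂ V (u' * e).toLinearMap) x := by
  obtain ⟨L, hL, htr⟩ := ContinuousLinearMap.hasFDerivAt_det_one (V := V)
  -- Multiplying by the inverse `e` of `u x` moves the base point to 1.
  have h1 : HasDerivAt (fun y => u y * e) (u' * e) x := h.mul_const e
  have h2 := HasFDerivAt.comp_hasDerivAt x (by simpa [he] using hL.restrictScalars ℝ) h1
  have hdet : LinearMap.det e.toLinearMap * LinearMap.det (u x).toLinearMap = 1 := by
    rw [mul_comm, ← map_mul]
    have : (u x).toLinearMap * e.toLinearMap = 1 := by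
      rw [← ContinuousLinearMap.toLinearMap_mul, he]; rfl
    simp [this]
  have h3 := h2.mul_const (LinearMap.det (u x).toLinearMap)
  refine (h3.congr_deriv ?_).congr_of_eventuallyEq (Eventually.of_forall fun y => ?_)
  · simp [htr, mul_comm]
  · have : (u y * e).toLinearMap = (u y).toLinearMap * e.toLinearMap := rfl
    simp only [Function.comp, this, map_mul, mul_assoc, hdet, mul_one]

end Det

/-! ### Eigenvalues with multiplicity and their continuity -/

section Eigenvalues

variable {V : Type*} [NormedAddCommGroup V] [NormedSpace ℂ V] [FiniteDimensional ℂ V]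

theorem Polynomial.roots_prod_X_sub_C_map {ι R : Type*} [Fintype ι] [CommRing R] [IsDomain R]
    (τ : ι → R) :
    (∏ i, (Polynomial.X - Polynomial.C (τ i))).roots = Finset.univ.val.map τ := by
  rw [← Polynomial.roots_multiset_prod_X_sub_C (Finset.univ.val.map τ), Multiset.map_map]
  rfl

theorem LinearMap.exists_charpoly_eq_prod (f : V →ₗ[ℂ] V) :
    ∃ τ : Fin (Module.finrank ℂ V) → ℂ,
      f.charpoly = ∏ i, (Polynomial.X - Polynomial.C (τ i)) := by
  have hs := IsAlgClosed.splits f.charpoly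
  have hc : f.charpoly.roots.toList.length = Module.finrank ℂ V := by
    rw [Multiset.length_toList, ← hs.natDegree_eq_card_roots, LinearMap.charpoly_natDegree]
  refine ⟨fun i => f.charpoly.roots.toList.get (i.cast hc.symm), ?_⟩
  conv_lhs => rw [hs.eq_prod_roots_of_monic f.charpoly_monic, ← Multiset.coe_toList
    f.charpoly.roots, Multiset.map_coe, Multiset.prod_coe, ← List.ofFn_get
    f.charpoly.roots.toList, List.map_ofFn, List.prod_ofFn]
  exact Fintype.prod_equiv (finCongr hc) _ _ fun i => rfl

/-- The eigenvalues of `f`, repeated according to their algebraic multiplicity. -/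
noncomputable def LinearMap.eig (f : V →ₗ[ℂ] V) : Fin (Module.finrank ℂ V) → ℂ :=
  f.exists_charpoly_eq_prod.choose

theorem LinearMap.charpoly_eq_prod_eig (f : V →ₗ[ℂ] V) :
    f.charpoly = ∏ i, (Polynomial.X - Polynomial.C (f.eig i)) :=
  f.exists_charpoly_eq_prod.choose_spec

theorem LinearMap.prod_sub_eig (f : V →ₗ[ℂ] V) (t : ℂ) :
    ∏ i, (t - f.eig i) = LinearMap.det (algebraMap ℂ (Module.End ℂ V) t - f) := by
  rw [← LinearMap.eval_charpoly, f.charpoly_eq_prod_eig, Polynomial.eval_prod]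
  simp

theorem LinearMap.roots_charpoly_eq_map_eig (f : V →ₗ[ℂ] V) :
    f.charpoly.roots = Finset.univ.val.map f.eig := by
  rw [f.charpoly_eq_prod_eig, Polynomial.roots_prod_X_sub_C_map]

theorem LinearMap.det_eq_prod_eig (f : V →ₗ[ℂ] V) : LinearMap.det f = ∏ i, f.eig i := by
  rw [Module.End.det_eq_prod_roots_charpoly_of_splits (IsAlgClosed.splits _),
    f.roots_charpoly_eq_map_eig]
  rfl

theorem LinearMap.exists_eigenvector_eig (f : V →ₗ[ℂ] V) (i : Fin (Module.finrank ℂ V)) :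
    ∃ v, ‖v‖ = 1 ∧ f v = f.eig i • v := by
  have h : Module.End.HasEigenvalue f (f.eig i) := by
    rw [Module.End.hasEigenvalue_iff_isRoot_charpoly, f.charpoly_eq_prod_eig,
      Polynomial.IsRoot.def, Polynomial.eval_prod]
    exact Finset.prod_eq_zero (Finset.mem_univ i) (by simp)
  obtain ⟨v, hv⟩ := h.exists_hasEigenvector
  refine ⟨(‖v‖⁻¹ : ℂ) • v, ?_, ?_⟩
  · have : ‖v‖ ≠ 0 := norm_ne_zero_iff.2 hv.2
    simp [norm_smul, this]
  · rw [map_smul, hv.apply_eq_smul, smul_comm]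

/-- Sums over the eigenvalues depend continuously on the operator, as long as the summand is
continuous along the set of points that can occur as eigenvalues. -/
theorem tendsto_sum_eig {ι : Type*} {l : Filter ι} {F : ι → V →L[ℂ] V} {f : V →L[ℂ] V}
    (hF : Tendsto F l (𝓝 f)) {r : ℝ} (hr : ∀ x i, ‖(F x).toLinearMap.eig i‖ ≤ r)
    {P : ι → ℂ → Prop} (hP : ∀ x i, P x ((F x).toLinearMap.eig i)) {h : ℂ → ℝ}
    (hh : ∀ i, Tendsto (fun p : ι × ℂ => h p.2)
      ((l ×ˢ 𝓝 (f.toLinearMap.eig i)) ⊓ 𝓟 {p | P p.1 p.2}) (𝓝 (h (f.toLinearMap.eig i)))) :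
    Tendsto (fun x => ∑ i, h ((F x).toLinearMap.eig i)) l (𝓝 (∑ i, h (f.toLinearMap.eig i))) := by
  -- The labelling `eig` is arbitrary and need not be continuous. Along an ultrafilter the tuple of
  -- eigenvalues converges by compactness, and passing to the limit in the characteristic polynomial
  -- shows that the limit is a reordering of the eigenvalues of `f`.
  rw [tendsto_iff_ultrafilter]
  intro g hg
  set G : ι → Fin (Module.finrank ℂ V) → ℂ := fun x => (F x).toLinearMap.eig with hG
  obtain ⟨τ, -, hτ⟩ := (isCompact_univ_pi (fun _ : Fin (Module.finrank ℂ V) =>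
    isCompact_closedBall (0 : ℂ) r)).ultrafilter_le_nhds (g.map G) (by
      rw [le_principal_iff]
      exact Eventually.of_forall (f := (g : Filter ι)) fun x i _ => by simpa using hr x i)
  have hGτ : Tendsto G g (𝓝 τ) := hτ
  have hGi (i) : Tendsto (fun x => G x i) g (𝓝 (τ i)) := (tendsto_pi_nhds.1 hGτ) i
  have hprod (t : ℂ) : ∏ i, (t - τ i) = ∏ i, (t - f.toLinearMap.eig i) := by
    have h1 : Tendsto (fun x => ∏ i, (t - G x i)) g (𝓝 (∏ i, (t - τ i))) :=
      tendsto_finsetProd _ fun i _ => (hGi i).const_sub t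
    refine tendsto_nhds_unique h1 ?_
    simp only [hG, LinearMap.prod_sub_eig]
    have h2 := (ContinuousLinearMap.differentiable_det_complex (V := V)).continuous.tendsto
      (algebraMap ℂ (V →L[ℂ] V) t - f)
    exact h2.comp ((hF.mono_left hg).const_sub _)
  have hpoly : ∏ i, (Polynomial.X - Polynomial.C (τ i)) =
      ∏ i, (Polynomial.X - Polynomial.C (f.toLinearMap.eig i)) :=
    Polynomial.funext fun t => by simpa [Polynomial.eval_prod] using hprod t
  have hms : Finset.univ.val.map τ = Finset.univ.val.map f.toLinearMap.eig := by
    have := congrArg Polynomial.roots hpoly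
    rwa [Polynomial.roots_prod_X_sub_C_map, Polynomial.roots_prod_X_sub_C_map] at this
  have hsum : ∑ i, h (f.toLinearMap.eig i) = ∑ i, h (τ i) := by
    have := congrArg (fun s : Multiset ℂ => (s.map h).sum) hms.symm
    simp only [Multiset.map_map] at this
    exact this
  rw [hsum]
  refine tendsto_finsetSum _ fun i _ => ?_
  obtain ⟨j, -, hj⟩ : ∃ j ∈ Finset.univ.val, f.toLinearMap.eig j = τ i := by
    rw [← Multiset.mem_map, ← hms]
    exact Multiset.mem_map_of_mem _ (Finset.mem_univ i)
  have h3 := hh j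
  rw [hj] at h3
  refine h3.comp (f := fun x => (x, G x i)) (tendsto_inf.2 ⟨?_, ?_⟩)
  · exact (show Tendsto id (g : Filter ι) l from hg).prodMk (hGi i)
  · exact tendsto_principal.2 (Eventually.of_forall fun x => hP x i)

end Eigenvalues

/-! ### Eigenvalues of U(x) and their motion near 1 -/

namespace UnitaryFamily

variable {V : Type*} [NormedAddCommGroup V] [InnerProductSpace ℂ V]

theorem op_apply (U : ℝ → V ≃ₗᵢ[ℂ] V) (x : ℝ) (v : V) : op U x v = U x v := rfl

theorem mem_W_iff {U : ℝ → V ≃ₗᵢ[ℂ] V} {x : ℝ} {v : V} : v ∈ W U x ↔ U x v = v := by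
  simp only [W, LinearMap.mem_ker, ContinuousLinearMap.coe_coe, sub_apply,
    ContinuousLinearMap.id_apply, op_apply, sub_eq_zero]
  exact eq_comm

theorem op_mul_inv (U : ℝ → V ≃ₗᵢ[ℂ] V) (x : ℝ) :
    op U x * (((U x)⁻¹).toContinuousLinearEquiv : V →L[ℂ] V) = 1 := by
  ext v
  exact (U x).apply_symm_apply v

theorem W_eq_eigenspace (U : ℝ → V ≃ₗᵢ[ℂ] V) (x : ℝ) :
    W U x = Module.End.eigenspace (op U x).toLinearMap 1 := by
  ext v
  rw [mem_W_iff, Module.End.mem_eigenspace_iff, one_smul]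
  rfl

/-- A unitary has no Jordan blocks: if w = Uv − v is fixed by U, then ⟨w, w⟩ = ⟨Uw, Uv⟩ − ⟨w, v⟩ =
0. So algebraic multiplicity at 1 is dim W. -/
theorem maxGenEigenspace_one (U : ℝ → V ≃ₗᵢ[ℂ] V) (x : ℝ) :
    Module.End.maxGenEigenspace (op U x).toLinearMap 1 = W U x := by
  apply le_antisymm
  · intro v hv
    obtain ⟨k, hk⟩ := Module.End.mem_maxGenEigenspace .. |>.1 hv
    clear hv
    induction k generalizing v with
    | zero =>
      have : v = 0 := by simpa using hk
      simp [this]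
    | succ k ih =>
      rw [pow_succ, Module.End.mul_apply] at hk
      have h := mem_W_iff.1 (ih hk)
      set w := ((op U x).toLinearMap - (1 : ℂ) • (1 : Module.End ℂ V)) v with hw
      have hw' : w = U x v - v := by simp [hw, op_apply]
      have h0 : inner ℂ w w = 0 := by
        nth_rw 2 [hw']
        rw [inner_sub_right, sub_eq_zero]
        nth_rw 1 [← h]
        exact (U x).inner_map_map w v
      rw [mem_W_iff, ← sub_eq_zero, ← hw']
      exact inner_self_eq_zero.1 h0
  · rw [W_eq_eigenspace]
    exact Module.End.genEigenspace_le_maximal ..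

theorem hasDerivAt_op {U : ℝ → V ≃ₗᵢ[ℂ] V} (hU : IsAnalytic U) (x : ℝ) :
    HasDerivAt (op U) (deriv (op U) x) x :=
  (hU x (Set.mem_univ x)).differentiableAt.hasDerivAt

theorem im_inner_deriv_pos {U : ℝ → V ≃ₗᵢ[ℂ] V} (hmono : IsMonotone U) {x : ℝ} {v : V}
    (hv : v ≠ 0) (hUv : U x v = v) : 0 < (inner ℂ v (deriv (op U) x v)).im := by
  have h := hmono x v hv
  have h1 : ((U x)⁻¹) v = v := by
    conv_lhs => rw [← hUv]
    exact (U x).symm_apply_apply v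
  have h2 : D U x v = (1 / Complex.I) • deriv (op U) x v := by
    change (1 / Complex.I) • deriv (op U) x (((U x)⁻¹) v) = _
    rw [h1]
  rw [h2, inner_smul_left] at h
  rw [← inner_conj_symm, Complex.conj_im]
  simpa using h

variable [FiniteDimensional ℂ V]

theorem norm_eig (U : ℝ → V ≃ₗᵢ[ℂ] V) (x : ℝ) (i) : ‖(op U x).toLinearMap.eig i‖ = 1 := by
  obtain ⟨v, hv, h⟩ := (op U x).toLinearMap.exists_eigenvector_eig i
  have h1 : ‖U x v‖ = ‖(op U x).toLinearMap.eig i • v‖ := congrArg norm h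
  rw [norm_smul, (U x).norm_map, hv, mul_one] at h1
  exact h1.symm

theorem card_eig_eq_one (U : ℝ → V ≃ₗᵢ[ℂ] V) (x : ℝ) :
    (Finset.univ.filter fun i => (op U x).toLinearMap.eig i = 1).card =
      Module.finrank ℂ (W U x) := by
  rw [← maxGenEigenspace_one, LinearMap.finrank_maxGenEigenspace_eq,
    ← Polynomial.count_roots, LinearMap.roots_charpoly_eq_map_eig, Multiset.count_map]
  simp only [eq_comm]
  rfl

/-- Eigenvalues close to `1` move in the positive direction along the unit circle. -/
theorem eventually_im_div_pos {U : ℝ → V ≃ₗᵢ[ℂ] V} (hU : IsAnalytic U) (hmono : IsMonotone U)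
    (x : ℝ) : ∀ᶠ p : ℝ × ℂ in 𝓝[≠] x ×ˢ 𝓝 1,
      ∀ v : V, ‖v‖ = 1 → U p.1 v = p.2 • v → 0 < p.2.im / (p.1 - x) := by
  -- Along an ultrafilter of counterexamples, the unit eigenvectors converge to a unit vector `v₀`
  -- fixed by `U x`; the limit of the difference quotients paired with `v₀` then contradicts
  -- `im_inner_deriv_pos`.
  by_contra hcon
  rw [not_eventually] at hcon
  have hne := frequently_iff_neBot.1 hcon
  obtain ⟨g, hgle⟩ := Ultrafilter.exists_le ((𝓝[≠] x ×ˢ 𝓝 (1 : ℂ)) ⊓ 𝓟 {p | ¬ ∀ v : V, ‖v‖ = 1 →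
    U p.1 v = p.2 • v → 0 < p.2.im / (p.1 - x)})
  have hg1 : Tendsto Prod.fst (g : Filter (ℝ × ℂ)) (𝓝[≠] x) :=
    tendsto_fst.mono_left (hgle.trans inf_le_left)
  have hg2 : Tendsto Prod.snd (g : Filter (ℝ × ℂ)) (𝓝 1) :=
    tendsto_snd.mono_left (hgle.trans inf_le_left)
  -- The default vector 0 keeps `v p` in the compact unit ball for every `p`.
  have hex : ∀ p : ℝ × ℂ, ∃ v : V, ‖v‖ ≤ 1 ∧ ((¬ ∀ v : V, ‖v‖ = 1 →
      U p.1 v = p.2 • v → 0 < p.2.im / (p.1 - x)) →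
        ‖v‖ = 1 ∧ U p.1 v = p.2 • v ∧ p.2.im / (p.1 - x) ≤ 0) := by
    intro p
    by_cases hp : ∀ v : V, ‖v‖ = 1 → U p.1 v = p.2 • v → 0 < p.2.im / (p.1 - x)
    · exact ⟨0, by simp, fun h => (h hp).elim⟩
    · have hp' := hp
      push Not at hp'
      obtain ⟨v, h1, h2, h3⟩ := hp'
      exact ⟨v, h1.le, fun _ => ⟨h1, h2, h3⟩⟩
  choose v hv hv' using hex
  have hev : ∀ᶠ p in (g : Filter (ℝ × ℂ)),
      ‖v p‖ = 1 ∧ U p.1 (v p) = p.2 • v p ∧ p.2.im / (p.1 - x) ≤ 0 :=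
    (hgle.trans inf_le_right) (mem_principal.2 fun p hp => hv' p hp)
  have : ProperSpace V := FiniteDimensional.proper ℂ V
  obtain ⟨v₀, -, hv₀⟩ := (isCompact_closedBall (0 : V) 1).ultrafilter_le_nhds (g.map v) (by
    rw [le_principal_iff]
    exact Eventually.of_forall (f := (g : Filter (ℝ × ℂ))) fun p => by simpa using hv p)
  have hlim : Tendsto v g (𝓝 v₀) := hv₀
  have hnorm : ‖v₀‖ = 1 := tendsto_nhds_unique hlim.norm
    (tendsto_const_nhds.congr' (hev.mono fun p hp => hp.1.symm))
  have hder := hasDerivAt_op hU x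
  have hop : Tendsto (fun p : ℝ × ℂ => op U p.1) g (𝓝 (op U x)) :=
    hder.continuousAt.tendsto.comp (hg1.mono_right nhdsWithin_le_nhds)
  have hfix : U x v₀ = v₀ := by
    have h1 : Tendsto (fun p => op U p.1 (v p)) g (𝓝 (op U x v₀)) := 
      (isBoundedBilinearMap_apply.continuous.tendsto (op U x, v₀)).comp (hop.prodMk_nhds hlim)
    have h2 : Tendsto (fun p => p.2 • v p) g (𝓝 ((1 : ℂ) • v₀)) := hg2.smul hlim
    rw [one_smul] at h2
    exact tendsto_nhds_unique h1 (h2.congr' (hev.mono fun p hp => hp.2.1.symm))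
  have hslope : Tendsto (fun p : ℝ × ℂ => slope (op U) x p.1) g (𝓝 (deriv (op U) x)) :=
    (hasDerivAt_iff_tendsto_slope.1 hder).comp hg1
  have hin : Tendsto (fun p => inner ℂ v₀ (v p)) g (𝓝 1) := by
    have : Tendsto (fun p => inner ℂ v₀ (v p)) g (𝓝 (inner ℂ v₀ v₀)) :=
      tendsto_const_nhds.inner hlim
    simpa [inner_self_eq_norm_sq_to_K, hnorm] using this
  have hquot : Tendsto (fun p : ℝ × ℂ => inner ℂ v₀ (slope (op U) x p.1 (v p)) /
      inner ℂ v₀ (v p)) g (𝓝 (inner ℂ v₀ (deriv (op U) x v₀))) := by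
    have := (tendsto_const_nhds (x := v₀)).inner (𝕜 := ℂ) 
      ((isBoundedBilinearMap_apply.continuous.tendsto (deriv (op U) x, v₀)).comp
        (hslope.prodMk_nhds hlim))
    have h := this.div hin one_ne_zero
    rw [div_one] at h
    exact h
  have him := (Complex.continuous_im.tendsto _).comp hquot
  refine absurd (im_inner_deriv_pos hmono (norm_ne_zero_iff.1 (by simp [hnorm])) hfix)
    (not_lt.2 (le_of_tendsto him ?_))
  filter_upwards [hev, hin.eventually_ne one_ne_zero] with p hp hp0
  -- Since `v₀` is fixed by the unitary `U x`, pairing with it replaces `U x` by the identity.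
  have hinner : inner ℂ v₀ (slope (op U) x p.1 (v p)) / inner ℂ v₀ (v p) =
      (((p.1 - x)⁻¹ : ℝ) : ℂ) * (p.2 - 1) := by
    rw [div_eq_iff hp0]
    have h1 : inner ℂ v₀ (U x (v p)) = inner ℂ v₀ (v p) := by
      conv_lhs => rw [← hfix]
      exact (U x).inner_map_map _ _
    rw [slope_def_module, smul_apply, sub_apply,
      op_apply, op_apply, hp.2.1, ← Complex.coe_smul, inner_smul_right, inner_sub_right,
      inner_smul_right, h1]
    ring
  simp only [Function.comp, hinner, Complex.im_ofReal_mul, Complex.sub_im, Complex.one_im, sub_zero]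
  rw [inv_mul_eq_div]
  exact hp.2.2

theorem eventually_W_eq_bot {U : ℝ → V ≃ₗᵢ[ℂ] V} (hU : IsAnalytic U) (hmono : IsMonotone U)
    (x : ℝ) : ∀ᶠ y in 𝓝[≠] x, W U y = ⊥ := by
  filter_upwards [(eventually_im_div_pos hU hmono x).curry] with y hy
  -- The eigenvalue is taken to be exactly 1, whose imaginary part is not positive.
  have h := hy.self_of_nhds
  rw [Submodule.eq_bot_iff]
  intro v hv
  by_contra hv0
  have hn : (‖v‖ : ℂ) ≠ 0 := by simpa using hv0
  have := h ((‖v‖⁻¹ : ℂ) • v) (by simp [norm_smul, hv0]) (by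
    rw [map_smul, mem_W_iff.1 hv, one_smul])
  simp at this

end UnitaryFamily

/-! ### Phases and their one-sided continuity -/

namespace UnitaryFamily

section Phase

open Complex ComplexConjugate

/-- The argument of a nonzero complex number, taken in `(0, 2π]`. -/
noncomputable def argPos (z : ℂ) : ℝ := Real.pi + arg (-z)

/-- The argument of a nonzero complex number, taken in `[0, 2π)`. -/
noncomputable def argNonneg (z : ℂ) : ℝ := Real.pi - arg (-conj z)

theorem argPos_pos (z : ℂ) : 0 < argPos z := by
  have := neg_pi_lt_arg (-z)
  unfold argPos; linarith

theorem argPos_le (z : ℂ) : argPos z ≤ 2 * Real.pi := by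
  have := arg_le_pi (-z)
  unfold argPos; linarith

theorem argNonneg_nonneg (z : ℂ) : 0 ≤ argNonneg z := by
  have := arg_le_pi (-conj z)
  unfold argNonneg; linarith

theorem exp_arg_mul_I {z : ℂ} (hz : ‖z‖ = 1) : exp (arg z * I) = z := by
  simpa [hz] using norm_mul_exp_arg_mul_I z

theorem exp_argPos {z : ℂ} (hz : ‖z‖ = 1) : exp (argPos z * I) = z := by
  rw [argPos, ofReal_add, add_mul, exp_add, exp_pi_mul_I, exp_arg_mul_I (by simpa using hz)]
  ring

theorem exp_argNonneg {z : ℂ} (hz : ‖z‖ = 1) : exp (argNonneg z * I) = z := by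
  have h : z * conj z = 1 := by rw [mul_conj, normSq_eq_norm_sq, hz]; norm_num
  have h0 : conj z ≠ 0 := right_ne_zero_of_mul (h ▸ one_ne_zero)
  rw [argNonneg, ofReal_sub, sub_mul, exp_sub, exp_pi_mul_I, exp_arg_mul_I (by simpa using hz),
    div_eq_iff (by simpa using h0)]
  rw [mul_neg, h]

theorem eq_one_of_argPos_eq {z : ℂ} (hz : ‖z‖ = 1) (h : argPos z = 2 * Real.pi) : z = 1 := by
  rw [← exp_argPos hz, h]
  simp

theorem eq_one_of_argNonneg_eq {z : ℂ} (hz : ‖z‖ = 1) (h : argNonneg z = 0) : z = 1 := by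
  rw [← exp_argNonneg hz, h]
  simp

theorem argPos_one : argPos 1 = 2 * Real.pi := by
  rw [argPos, arg_neg_one]; ring

theorem argNonneg_one : argNonneg 1 = 0 := by
  rw [argNonneg, map_one, arg_neg_one]; ring

theorem arg_neg_ne_pi {z : ℂ} (hz : ‖z‖ = 1) (h1 : z ≠ 1) : arg (-z) ≠ Real.pi := fun h =>
  h1 (eq_one_of_argPos_eq hz (by rw [argPos, h]; ring))

theorem argPos_eq_argNonneg {z : ℂ} (hz : ‖z‖ = 1) (h1 : z ≠ 1) : argPos z = argNonneg z := by
  rw [argPos, argNonneg, ← map_neg, arg_conj, if_neg (arg_neg_ne_pi hz h1)]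
  ring

theorem argPos_sub_argNonneg {z : ℂ} (hz : ‖z‖ = 1) :
    argPos z - argNonneg z = if z = 1 then 2 * Real.pi else 0 := by
  split_ifs with h
  · rw [h, argPos_one, argNonneg_one, sub_zero]
  · rw [argPos_eq_argNonneg hz h, sub_self]

theorem continuousAt_argPos {z : ℂ} (hz : ‖z‖ = 1) (h1 : z ≠ 1) : ContinuousAt argPos z := by
  have h0 : -z ≠ 0 := by rintro h; simp [neg_eq_zero.1 h] at hz
  have := continuousAt_arg (mem_slitPlane_iff_arg.2 ⟨arg_neg_ne_pi hz h1, h0⟩)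
  exact continuousAt_const.add (this.comp continuousAt_neg)

theorem continuousAt_argNonneg {z : ℂ} (hz : ‖z‖ = 1) (h1 : z ≠ 1) :
    ContinuousAt argNonneg z := by
  have h2 : ‖conj z‖ = 1 := by simpa using hz
  have h3 : conj z ≠ 1 := fun h => h1 (by simpa using congrArg conj h)
  have h4 : argNonneg = fun z => 2 * Real.pi - argPos (conj z) := by
    ext z; rw [argNonneg, argPos]; ring
  rw [h4]
  have h5 : ContinuousAt (fun z => argPos (conj z)) z :=
    ContinuousAt.comp (f := fun z => conj z) (continuousAt_argPos h2 h3)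
      continuous_conj.continuousAt
  exact continuousAt_const.sub h5

/-- `arg` is continuous from above at the negative axis, and z ↦ −z carries the lower half-plane to
the upper one. -/
theorem continuousWithinAt_argPos_one : ContinuousWithinAt argPos {z | z.im ≤ 0} 1 := by
  have h := (continuousWithinAt_arg_of_re_neg_of_im_zero (z := -1) (by simp) (by simp)).tendsto
  have h2 : Tendsto (fun z : ℂ => -z) (𝓝[{z | z.im ≤ 0}] 1) (𝓝[{z | 0 ≤ z.im}] (-1)) :=
    tendsto_nhdsWithin_iff.2 ⟨(continuous_neg.tendsto 1).mono_left nhdsWithin_le_nhds,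
      eventually_nhdsWithin_of_forall fun z hz => by simpa using hz⟩
  exact (h.comp h2).const_add Real.pi

theorem continuousWithinAt_argNonneg_one : ContinuousWithinAt argNonneg {z | 0 ≤ z.im} 1 := by
  have h := (continuousWithinAt_arg_of_re_neg_of_im_zero (z := -conj 1)
    (by simp) (by simp)).tendsto
  have h2 : Tendsto (fun z : ℂ => -conj z) (𝓝[{z | 0 ≤ z.im}] 1) (𝓝[{z | 0 ≤ z.im}] (-conj 1)) :=
    tendsto_nhdsWithin_iff.2 ⟨(continuous_conj.neg.tendsto 1).mono_left nhdsWithin_le_nhds,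
      eventually_nhdsWithin_of_forall fun z hz => by simpa using hz⟩
  exact (h.comp h2).const_sub Real.pi

/-- The values lie in the discrete set c + 2πℤ, so convergence means eventual equality. -/
theorem eventually_eq_of_exp_eq {ι : Type*} {l : Filter ι} {f : ι → ℝ} {c : ℝ}
    (hf : Tendsto f l (𝓝 c)) (h : ∀ x, exp (f x * I) = exp (c * I)) : ∀ᶠ x in l, f x = c := by
  filter_upwards [hf (Metric.ball_mem_nhds c Real.two_pi_pos)] with x hx
  obtain ⟨n, hn⟩ := exp_eq_exp_iff_exists_int.1 (h x)
  have hn' : f x = c + n * (2 * Real.pi) := by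
    have : (f x : ℂ) = c + n * (2 * Real.pi) :=
      mul_right_cancel₀ I_ne_zero (by rw [hn]; ring)
    exact_mod_cast this
  have hx' : |f x - c| < 2 * Real.pi := hx
  rw [hn', add_sub_cancel_left, abs_mul, abs_of_pos Real.two_pi_pos,
    mul_lt_iff_lt_one_left Real.two_pi_pos] at hx'
  have : n = 0 := Int.abs_lt_one_iff.1 (by exact_mod_cast hx')
  simp [hn', this]

end Phase

variable {V : Type*} [NormedAddCommGroup V] [InnerProductSpace ℂ V] [FiniteDimensional ℂ V]

/-- The sum of the phases, in `(0, 2π]`, of the eigenvalues of `U x`. -/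
noncomputable def phasePos (U : ℝ → V ≃ₗᵢ[ℂ] V) (x : ℝ) : ℝ :=
  ∑ i, argPos ((op U x).toLinearMap.eig i)

/-- The sum of the phases, in `[0, 2π)`, of the eigenvalues of `U x`. -/
noncomputable def phaseNonneg (U : ℝ → V ≃ₗᵢ[ℂ] V) (x : ℝ) : ℝ :=
  ∑ i, argNonneg ((op U x).toLinearMap.eig i)

theorem phasePos_sub_phaseNonneg (U : ℝ → V ≃ₗᵢ[ℂ] V) (x : ℝ) :
    phasePos U x - phaseNonneg U x = 2 * Real.pi * Module.finrank ℂ (W U x) := by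
  rw [phasePos, phaseNonneg, ← Finset.sum_sub_distrib,
    Finset.sum_congr rfl fun i _ => argPos_sub_argNonneg (norm_eig U x i), ← Finset.sum_filter,
    Finset.sum_const, card_eig_eq_one, nsmul_eq_mul, mul_comm]

theorem exp_phasePos (U : ℝ → V ≃ₗᵢ[ℂ] V) (x : ℝ) :
    Complex.exp (phasePos U x * Complex.I) = LinearMap.det (op U x).toLinearMap := by
  rw [phasePos, Complex.ofReal_sum, Finset.sum_mul, Complex.exp_sum, LinearMap.det_eq_prod_eig]
  exact Finset.prod_congr rfl fun i _ => exp_argPos (norm_eig U x i)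

theorem exp_phaseNonneg (U : ℝ → V ≃ₗᵢ[ℂ] V) (x : ℝ) :
    Complex.exp (phaseNonneg U x * Complex.I) = LinearMap.det (op U x).toLinearMap := by
  rw [phaseNonneg, Complex.ofReal_sum, Finset.sum_mul, Complex.exp_sum,
    LinearMap.det_eq_prod_eig]
  exact Finset.prod_congr rfl fun i _ => exp_argNonneg (norm_eig U x i)

/-- To the right of x, eigenvalues near 1 lie in the upper half-plane, where the argument in [0, 2π)
is near its value 0 at 1. -/
theorem tendsto_phaseNonneg {U : ℝ → V ≃ₗᵢ[ℂ] V} (hU : IsAnalytic U) (hmono : IsMonotone U)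
    (x : ℝ) : Tendsto (phaseNonneg U) (𝓝[>] x) (𝓝 (phaseNonneg U x)) := by
  refine tendsto_sum_eig (r := 1) (P := fun y z => ∃ v : V, ‖v‖ = 1 ∧ U y v = z • v)
    ((hasDerivAt_op hU x).continuousAt.tendsto.mono_left nhdsWithin_le_nhds)
    (fun y i => (norm_eig U y i).le) (fun y i => (op U y).toLinearMap.exists_eigenvector_eig i)
    fun i => ?_
  by_cases h1 : (op U x).toLinearMap.eig i = 1
  · rw [h1]
    refine continuousWithinAt_argNonneg_one.tendsto.comp (tendsto_nhdsWithin_iff.2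
      ⟨tendsto_snd.mono_left inf_le_left, ?_⟩)
    have hle : 𝓝[>] x ×ˢ 𝓝 (1 : ℂ) ≤ 𝓝[≠] x ×ˢ 𝓝 1 :=
      prod_mono_left _ (nhdsWithin_mono x fun y hy => ne_of_gt hy)
    have hgt : ∀ᶠ p : ℝ × ℂ in 𝓝[>] x ×ˢ 𝓝 1, x < p.1 :=
      tendsto_fst.eventually self_mem_nhdsWithin
    filter_upwards [mem_inf_of_left (hle (eventually_im_div_pos hU hmono x)), mem_inf_of_left hgt,
      mem_inf_of_right (mem_principal_self _)] with p hp hpx ⟨v, hv, hpv⟩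
    exact ((div_pos_iff_of_pos_right (sub_pos.2 hpx)).1 (hp v hv hpv)).le
  · exact (continuousAt_argNonneg (norm_eig U x i) h1).tendsto.comp
      (tendsto_snd.mono_left inf_le_left)

/-- Mirror image: to the left of x, eigenvalues near 1 lie below the real axis, with argument in (0,
2π] near 2π. -/
theorem tendsto_phasePos {U : ℝ → V ≃ₗᵢ[ℂ] V} (hU : IsAnalytic U) (hmono : IsMonotone U)
    (x : ℝ) : Tendsto (phasePos U) (𝓝[<] x) (𝓝 (phasePos U x)) := by
  refine tendsto_sum_eig (r := 1) (P := fun y z => ∃ v : V, ‖v‖ = 1 ∧ U y v = z • v)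
    ((hasDerivAt_op hU x).continuousAt.tendsto.mono_left nhdsWithin_le_nhds)
    (fun y i => (norm_eig U y i).le) (fun y i => (op U y).toLinearMap.exists_eigenvector_eig i)
    fun i => ?_
  by_cases h1 : (op U x).toLinearMap.eig i = 1
  · rw [h1]
    refine continuousWithinAt_argPos_one.tendsto.comp (tendsto_nhdsWithin_iff.2
      ⟨tendsto_snd.mono_left inf_le_left, ?_⟩)
    have hle : 𝓝[<] x ×ˢ 𝓝 (1 : ℂ) ≤ 𝓝[≠] x ×ˢ 𝓝 1 :=
      prod_mono_left _ (nhdsWithin_mono x fun y hy => ne_of_lt hy)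
    have hlt : ∀ᶠ p : ℝ × ℂ in 𝓝[<] x ×ˢ 𝓝 1, p.1 < x :=
      tendsto_fst.eventually self_mem_nhdsWithin
    filter_upwards [mem_inf_of_left (hle (eventually_im_div_pos hU hmono x)), mem_inf_of_left hlt,
      mem_inf_of_right (mem_principal_self _)] with p hp hpx ⟨v, hv, hpv⟩
    by_contra hcon
    exact absurd (hp v hv hpv)
      (not_lt.2 (div_nonpos_of_nonneg_of_nonpos (not_le.1 hcon).le (sub_neg.2 hpx).le))
  · exact (continuousAt_argPos (norm_eig U x i) h1).tendsto.comp
      (tendsto_snd.mono_left inf_le_left)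

theorem phasePos_nonneg (U : ℝ → V ≃ₗᵢ[ℂ] V) (x : ℝ) : 0 ≤ phasePos U x :=
  Finset.sum_nonneg fun _ _ => (argPos_pos _).le

theorem phasePos_pos [Nontrivial V] (U : ℝ → V ≃ₗᵢ[ℂ] V) (x : ℝ) : 0 < phasePos U x :=
  have : NeZero (Module.finrank ℂ V) := ⟨Module.finrank_pos.ne'⟩
  Finset.sum_pos (fun _ _ => argPos_pos _) Finset.univ_nonempty

theorem phasePos_le (U : ℝ → V ≃ₗᵢ[ℂ] V) (x : ℝ) :
    phasePos U x ≤ 2 * Real.pi * Module.finrank ℂ V := by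
  refine (Finset.sum_le_card_nsmul _ _ _ fun i _ => argPos_le _).trans_eq ?_
  rw [Finset.card_univ, Fintype.card_fin, nsmul_eq_mul, mul_comm]

theorem phaseNonneg_nonneg (U : ℝ → V ≃ₗᵢ[ℂ] V) (x : ℝ) : 0 ≤ phaseNonneg U x :=
  Finset.sum_nonneg fun _ _ => argNonneg_nonneg _

theorem eq_one_of_forall_eig {U : ℝ → V ≃ₗᵢ[ℂ] V} {x : ℝ}
    (h : ∀ i, (op U x).toLinearMap.eig i = 1) : U x = 1 := by
  have h1 := card_eig_eq_one U x
  rw [Finset.filter_true_of_mem fun i _ => h i, Finset.card_univ, Fintype.card_fin] at h1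
  have h2 := Submodule.eq_top_of_finrank_eq h1.symm
  ext v
  exact mem_W_iff.1 (h2 ▸ Submodule.mem_top)

theorem eq_one_of_phasePos_eq {U : ℝ → V ≃ₗᵢ[ℂ] V} {x : ℝ}
    (h : phasePos U x = 2 * Real.pi * Module.finrank ℂ V) : U x = 1 := by
  have hs : ∑ i, argPos ((op U x).toLinearMap.eig i) =
      ∑ _i : Fin (Module.finrank ℂ V), 2 * Real.pi := by
    rw [Finset.sum_const, Finset.card_univ, Fintype.card_fin, nsmul_eq_mul, mul_comm, ← h,
      phasePos]
  exact eq_one_of_forall_eig fun i => eq_one_of_argPos_eq (norm_eig U x i)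
    ((Finset.sum_eq_sum_iff_of_le fun _ _ => argPos_le _).1 hs i (Finset.mem_univ i))

theorem eq_one_of_phaseNonneg_eq {U : ℝ → V ≃ₗᵢ[ℂ] V} {x : ℝ}
    (h : phaseNonneg U x = 0) : U x = 1 :=
  eq_one_of_forall_eig fun i => eq_one_of_argNonneg_eq (norm_eig U x i)
    ((Finset.sum_eq_zero_iff_of_nonneg fun _ _ => argNonneg_nonneg _).1 h i (Finset.mem_univ i))

end UnitaryFamily

/-! ### Step functions on the line -/

theorem finite_inter_Icc_of_eventually_notMem {s : Set ℝ}
    (h : ∀ x, ∀ᶠ y in 𝓝[≠] x, y ∉ s) (a b : ℝ) : (s ∩ Set.Icc a b).Finite := by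
  by_contra hinf
  obtain ⟨x, -, hx⟩ := Set.Infinite.exists_accPt_of_subset_isCompact hinf isCompact_Icc
    Set.inter_subset_right
  exact (accPt_iff_frequently_nhdsNE.1 hx) ((h x).mono fun y hy hy' => hy hy'.1)

/-- A right-continuous, locally piecewise constant function is determined by its jumps. -/
theorem sum_jumps_eq {f w : ℝ → ℝ} {s : Finset ℝ} {a b : ℝ} (hab : a ≤ b)
    (hs : ∀ x ∈ Set.Icc a b, x ∉ s → w x = 0)
    (hright : ∀ x, ∀ᶠ y in 𝓝[>] x, f y = f x)
    (hleft : ∀ x, ∀ᶠ y in 𝓝[<] x, f y = f x - w x) :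
    ∑ x ∈ s with a < x ∧ x ≤ b, w x = f b - f a := by
  classical
  -- `S` is the right-continuous step function with the same jumps as `f` on [a, b], so `f - S` is
  -- locally constant there.
  set S : ℝ → ℝ := fun y => ∑ x ∈ s with x ≤ y, w x with hS
  have hfar (x : ℝ) : ∀ᶠ y in 𝓝 x, ∀ z ∈ s, z ≠ x → (z ≤ y ↔ z ≤ x) := by
    rw [Filter.eventually_all_finset]
    intro z _
    rcases lt_trichotomy z x with hz | hz | hz
    · filter_upwards [lt_mem_nhds hz] with y hy _
      exact iff_of_true hy.le hz.le
    · exact Eventually.of_forall fun y h => (h hz).elim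
    · filter_upwards [gt_mem_nhds hz] with y hy _
      exact iff_of_false (not_le.2 hy) (not_le.2 hz)
  have hSright (x : ℝ) : ∀ᶠ y in 𝓝[>] x, S y = S x := by
    filter_upwards [nhdsWithin_le_nhds (hfar x), self_mem_nhdsWithin] with y hy hxy
    refine Finset.sum_congr (Finset.filter_congr fun z hz => ?_) fun _ _ => rfl
    by_cases hzx : z = x
    · rw [hzx]
      exact iff_of_true (le_of_lt hxy) le_rfl
    · exact hy z hz hzx
  have hSleft (x : ℝ) (hx : x ∈ Set.Icc a b) : ∀ᶠ y in 𝓝[<] x, S y = S x - w x := by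
    filter_upwards [nhdsWithin_le_nhds (hfar x), self_mem_nhdsWithin] with y hy hxy
    have hyx : y < x := hxy
    by_cases hxs : x ∈ s
    · rw [eq_sub_iff_add_eq', hS]
      have hmem : x ∉ s.filter (· ≤ y) := fun h => absurd (Finset.mem_filter.1 h).2 (not_le.2 hyx)
      change w x + ∑ z ∈ s with z ≤ y, w z = ∑ z ∈ s with z ≤ x, w z
      rw [← Finset.sum_insert hmem]
      refine Finset.sum_congr (Finset.ext fun z => ?_) fun _ _ => rfl
      by_cases hzx : z = x
      · simp [hzx, hxs]
      · simp only [Finset.mem_insert, Finset.mem_filter, hzx, false_or]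
        exact and_congr_right fun hz => hy z hz hzx
    · rw [hs x hx hxs, sub_zero]
      refine Finset.sum_congr (Finset.filter_congr fun z hz => ?_) fun _ _ => rfl
      exact hy z hz fun h => hxs (h ▸ hz)
  have hloc (x : ℝ) (hx : x ∈ Set.Icc a b) : ∀ᶠ y in 𝓝 x, f y - S y = f x - S x := by
    rw [← nhdsNE_sup_pure, ← Set.Iio_union_Ioi, nhdsWithin_union]
    refine eventually_sup.2 ⟨eventually_sup.2 ⟨?_, ?_⟩, ?_⟩
    · filter_upwards [hleft x, hSleft x hx] with y h1 h2
      rw [h1, h2]; ring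
    · filter_upwards [hright x, hSright x] with y h1 h2
      rw [h1, h2]
    · exact eventually_pure.2 rfl
  have hder (x : ℝ) (hx : x ∈ Set.Icc a b) : HasDerivAt (fun y => f y - S y) 0 x :=
    (hasDerivAt_const x (f x - S x)).congr_of_eventuallyEq (hloc x hx)
  have hconst := constant_of_has_deriv_right_zero
    (fun x hx => (hder x hx).continuousAt.continuousWithinAt)
    (fun x hx => (hder x (Set.Ico_subset_Icc_self hx)).hasDerivWithinAt) b
    (Set.right_mem_Icc.2 hab)
  have hsplit : S b = S a + ∑ x ∈ s with a < x ∧ x ≤ b, w x := by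
    rw [hS]
    change ∑ x ∈ s with x ≤ b, w x = ∑ x ∈ s with x ≤ a, w x + _
    rw [← Finset.sum_union]
    · refine Finset.sum_congr (Finset.ext fun z => ?_) fun _ _ => rfl
      simp only [Finset.mem_union, Finset.mem_filter]
      constructor
      · rintro ⟨h1, h2⟩
        exact (le_or_gt z a).imp (fun h => ⟨h1, h⟩) fun h => ⟨h1, h, h2⟩
      · rintro (⟨h1, h2⟩ | ⟨h1, h2, h3⟩)
        exacts [⟨h1, h2.trans hab⟩, ⟨h1, h3⟩]
    · rw [Finset.disjoint_filter]
      exact fun z _ h1 h2 => absurd h2.1 (not_lt.2 h1)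
  linarith

/-! ### Winding of the determinant and the exact count -/

namespace UnitaryFamily

variable {V : Type*} [NormedAddCommGroup V] [InnerProductSpace ℂ V] [FiniteDimensional ℂ V]

theorem eventually_notMem_Z {U : ℝ → V ≃ₗᵢ[ℂ] V} (hU : IsAnalytic U) (hmono : IsMonotone U)
    (x : ℝ) : ∀ᶠ y in 𝓝[≠] x, y ∉ Z U :=
  (eventually_W_eq_bot hU hmono x).mono fun _ hy => not_not.2 hy

theorem isDiscrete_Z {U : ℝ → V ≃ₗᵢ[ℂ] V} (hU : IsAnalytic U) (hmono : IsMonotone U) :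
    IsDiscrete (Z U) := by
  rw [isDiscrete_iff_nhdsNE]
  intro x _
  rw [inf_principal_eq_bot]
  exact eventually_notMem_Z hU hmono x

theorem continuous_D {U : ℝ → V ≃ₗᵢ[ℂ] V} (hU : IsAnalytic U) : Continuous (D U) := by
  have : CompleteSpace V := FiniteDimensional.complete ℂ V
  have h1 : Continuous (deriv (op U)) :=
    continuous_iff_continuousAt.2 fun x => (hU.deriv x (Set.mem_univ x)).continuousAt
  -- The inverse of a unitary is its adjoint, which gives its continuity in x.
  have h2 : Continuous fun x => ContinuousLinearMap.adjoint (op U x) :=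
    (ContinuousLinearMap.adjoint (𝕜 := ℂ) (E := V) (F := V)).continuous.comp
      (continuous_iff_continuousAt.2 fun x => (hasDerivAt_op hU x).continuousAt)
  have h3 (x : ℝ) : ContinuousLinearMap.adjoint (op U x) =
      (((U x)⁻¹).toContinuousLinearEquiv : V →L[ℂ] V) :=
    LinearIsometryEquiv.adjoint_eq_symm (U x)
  simp only [h3] at h2
  have h4 : Continuous fun x => (1 / Complex.I) •
      (deriv (op U) x ∘L (((U x)⁻¹).toContinuousLinearEquiv : V →L[ℂ] V)) :=
    (h1.clm_comp h2).const_smul (1 / Complex.I)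
  exact h4

theorem continuous_trace_D {U : ℝ → V ≃ₗᵢ[ℂ] V} (hU : IsAnalytic U) :
    Continuous fun x => LinearMap.trace ℂ V (D U x).toLinearMap := by
  have h : Continuous (LinearMap.trace ℂ V ∘ₗ ContinuousLinearMap.coeLM ℂ) :=
    LinearMap.continuous_of_finiteDimensional (E := V →L[ℂ] V) _
  exact h.comp (continuous_D hU)

theorem hasDerivAt_det {U : ℝ → V ≃ₗᵢ[ℂ] V} (hU : IsAnalytic U) (x : ℝ) :
    HasDerivAt (fun y => LinearMap.det (op U y).toLinearMap)
      (LinearMap.det (op U x).toLinearMap *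
        (LinearMap.trace ℂ V (D U x).toLinearMap * Complex.I)) x := by
  convert (hasDerivAt_op hU x).linearMap_det (op_mul_inv U x) using 2
  have : deriv (op U) x * (((U x)⁻¹).toContinuousLinearEquiv : V →L[ℂ] V) =
      Complex.I • D U x := by
    rw [D, smul_smul, mul_one_div_cancel Complex.I_ne_zero, one_smul]
    rfl
  rw [this, ContinuousLinearMap.toLinearMap_smul, map_smul, smul_eq_mul, mul_comm]

theorem norm_det (U : ℝ → V ≃ₗᵢ[ℂ] V) (x : ℝ) : ‖LinearMap.det (op U x).toLinearMap‖ = 1 := by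
  rw [LinearMap.det_eq_prod_eig, norm_prod]
  exact Finset.prod_eq_one fun i _ => norm_eig U x i

theorem hasDerivAt_integral_trace {U : ℝ → V ≃ₗᵢ[ℂ] V} (hU : IsAnalytic U) (A x : ℝ) :
    HasDerivAt (fun y => ∫ t in A..y, LinearMap.trace ℂ V (D U t).toLinearMap)
      (LinearMap.trace ℂ V (D U x).toLinearMap) x :=
  (continuous_trace_D hU).integral_hasStrictDerivAt A x |>.hasDerivAt

theorem det_eq_mul_exp {U : ℝ → V ≃ₗᵢ[ℂ] V} (hU : IsAnalytic U) (A x : ℝ) :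
    LinearMap.det (op U x).toLinearMap = LinearMap.det (op U A).toLinearMap *
      Complex.exp ((∫ t in A..x, LinearMap.trace ℂ V (D U t).toLinearMap) * Complex.I) := by
  set G : ℝ → ℂ := fun y => ∫ t in A..y, LinearMap.trace ℂ V (D U t).toLinearMap with hG
  have h (y : ℝ) : HasDerivAt (fun y => LinearMap.det (op U y).toLinearMap *
      Complex.exp (-(G y * Complex.I))) 0 y := by
    refine ((hasDerivAt_det hU y).mul
      ((hasDerivAt_integral_trace hU A y).mul_const Complex.I).neg.cexp).congr_deriv ?_
    ring
  have hc := is_const_of_deriv_eq_zero (fun y => (h y).differentiableAt) (fun y => (h y).deriv) x A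
  have hA : G A = 0 := intervalIntegral.integral_same
  simp only [hA, zero_mul, neg_zero, Complex.exp_zero, mul_one] at hc
  rw [← hc, mul_assoc, ← Complex.exp_add, neg_add_cancel, Complex.exp_zero, mul_one]

/-- Both determinants have modulus 1, hence so does exp(i ∫ tr D); symmetry of D is not needed. -/
theorem im_integral_trace {U : ℝ → V ≃ₗᵢ[ℂ] V} (hU : IsAnalytic U) (A x : ℝ) :
    (∫ t in A..x, LinearMap.trace ℂ V (D U t).toLinearMap).im = 0 := by
  have h := congrArg norm (det_eq_mul_exp hU A x)
  rw [norm_mul, norm_det, norm_det, one_mul, Complex.norm_exp, Complex.mul_I_re, eq_comm,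
    Real.exp_eq_one_iff, neg_eq_zero] at h
  exact h

/-- The real number `∫ t in A..x, tr D(t)`. -/
noncomputable def totalPhase (U : ℝ → V ≃ₗᵢ[ℂ] V) (A x : ℝ) : ℝ :=
  (∫ t in A..x, LinearMap.trace ℂ V (D U t).toLinearMap).re

theorem ofReal_totalPhase {U : ℝ → V ≃ₗᵢ[ℂ] V} (hU : IsAnalytic U) (A x : ℝ) :
    (totalPhase U A x : ℂ) = ∫ t in A..x, LinearMap.trace ℂ V (D U t).toLinearMap :=
  Complex.ext rfl (im_integral_trace hU A x).symm

theorem continuous_totalPhase {U : ℝ → V ≃ₗᵢ[ℂ] V} (hU : IsAnalytic U) (A : ℝ) :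
    Continuous (totalPhase U A) :=
  Complex.continuous_re.comp
    (continuous_iff_continuousAt.2 fun x => (hasDerivAt_integral_trace hU A x).continuousAt)

/-- The right side does not depend on x, which confines `totalPhase` minus either phase sum to a
coset of 2πℤ. -/
theorem exp_totalPhase_sub {U : ℝ → V ≃ₗᵢ[ℂ] V} (hU : IsAnalytic U) (A x : ℝ) {φ : ℝ}
    (hφ : Complex.exp (φ * Complex.I) = LinearMap.det (op U x).toLinearMap) :
    Complex.exp ((totalPhase U A x - φ : ℝ) * Complex.I) =
      (LinearMap.det (op U A).toLinearMap)⁻¹ := by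
  have h0 (y : ℝ) : LinearMap.det (op U y).toLinearMap ≠ 0 :=
    norm_ne_zero_iff.1 (by rw [norm_det]; exact one_ne_zero)
  have h := det_eq_mul_exp hU A x
  rw [Complex.ofReal_sub, sub_mul, Complex.exp_sub, ofReal_totalPhase hU, hφ, h]
  field_simp [h0 A, Complex.exp_ne_zero]

theorem finsum_finrank_W {U : ℝ → V ≃ₗᵢ[ℂ] V} (hU : IsAnalytic U) (hmono : IsMonotone U)
    {A B : ℝ} (hAB : A < B) :
    2 * Real.pi * (∑ᶠ x ∈ Set.Ioo A B, Module.finrank ℂ (W U x) : ℕ) =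
      totalPhase U A B - phasePos U B + phaseNonneg U A := by
  classical
  have hfin := finite_inter_Icc_of_eventually_notMem (eventually_notMem_Z hU hmono) A B
  have hW {x : ℝ} (hx : x ∈ Set.Icc A B) (hxs : x ∉ hfin.toFinset) :
      Module.finrank ℂ (W U x) = 0 := by
    have : W U x = ⊥ := by
      by_contra h
      exact hxs (hfin.mem_toFinset.2 ⟨h, hx⟩)
    rw [this, finrank_bot]
  have hjump := sum_jumps_eq (f := fun x => totalPhase U A x - phaseNonneg U x)
    (w := fun x => 2 * Real.pi * Module.finrank ℂ (W U x)) (s := hfin.toFinset) hAB.le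
    (fun x hx hxs => by simp [hW hx hxs])
    (fun x => eventually_eq_of_exp_eq
      (((continuous_totalPhase hU A).tendsto x |>.mono_left nhdsWithin_le_nhds).sub
        (tendsto_phaseNonneg hU hmono x))
      fun y => by rw [exp_totalPhase_sub hU A y (exp_phaseNonneg U y),
        exp_totalPhase_sub hU A x (exp_phaseNonneg U x)])
    (fun x => by
      -- On the left the continuous quantity is `phasePos`; it agrees with `phaseNonneg` at nearby
      -- y, where W(y) = 0, but exceeds it at x by the jump.
      have h1 := eventually_eq_of_exp_eq
        (((continuous_totalPhase hU A).tendsto x |>.mono_left nhdsWithin_le_nhds).sub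
          (tendsto_phasePos hU hmono x))
        fun y => by rw [exp_totalPhase_sub hU A y (exp_phasePos U y),
          exp_totalPhase_sub hU A x (exp_phasePos U x)]
      have h2 : ∀ᶠ y in 𝓝[<] x, W U y = ⊥ :=
        nhdsWithin_mono x (fun y hy => ne_of_lt hy) (eventually_W_eq_bot hU hmono x)
      filter_upwards [h1, h2] with y hy hyW
      have hy' := phasePos_sub_phaseNonneg U y
      rw [hyW, finrank_bot, Nat.cast_zero, mul_zero] at hy'
      linarith [phasePos_sub_phaseNonneg U x])
  have hsum : ∑ᶠ x ∈ Set.Ioo A B, Module.finrank ℂ (W U x) =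
      ∑ x ∈ hfin.toFinset with A < x ∧ x < B, Module.finrank ℂ (W U x) := by
    rw [finsum_mem_eq_sum_of_inter_support_eq]
    ext x
    simp only [Set.mem_inter_iff, Set.mem_Ioo, Function.mem_support, Finset.coe_filter,
      Set.mem_ofPred_eq]
    constructor
    · rintro ⟨h1, h2⟩
      exact ⟨⟨by_contra fun h => h2 (hW ⟨h1.1.le, h1.2.le⟩ h), h1⟩, h2⟩
    · rintro ⟨⟨_, h1⟩, h2⟩
      exact ⟨h1, h2⟩
  -- Splitting off the jump at B turns `phaseNonneg U B` into `phasePos U B`.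
  have hlast : ∑ x ∈ hfin.toFinset with A < x ∧ x ≤ B, 2 * Real.pi * Module.finrank ℂ (W U x) =
      ∑ x ∈ hfin.toFinset with A < x ∧ x < B, 2 * Real.pi * (Module.finrank ℂ (W U x) : ℝ) +
        2 * Real.pi * Module.finrank ℂ (W U B) := by
    have hB : B ∉ hfin.toFinset.filter fun x => A < x ∧ x < B := by simp
    rw [add_comm, ← Finset.sum_insert (f := fun x => 2 * Real.pi *
      (Module.finrank ℂ (W U x) : ℝ)) hB]
    refine Finset.sum_subset (fun x hx => ?_) fun x hx hx' => ?_
    · simp only [Finset.mem_filter, Finset.mem_insert] at hx ⊢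
      rcases hx.2.2.lt_or_eq with h | h
      · exact Or.inr ⟨hx.1, hx.2.1, h⟩
      · exact Or.inl h
    · have hxB : x = B ∧ x ∉ hfin.toFinset := by
        rcases Finset.mem_insert.1 hx with h | h
        · exact ⟨h, fun hxs => hx' (Finset.mem_filter.2 ⟨hxs, h ▸ hAB, h.le⟩)⟩
        · obtain ⟨h1, h2, h3⟩ := Finset.mem_filter.1 h
          exact (hx' (Finset.mem_filter.2 ⟨h1, h2, h3.le⟩)).elim
      rw [hW ⟨hxB.1 ▸ hAB.le, hxB.1.le⟩ hxB.2, Nat.cast_zero, mul_zero]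
  have hAA : totalPhase U A A = 0 := by simp [totalPhase]
  rw [hlast, hAA] at hjump
  rw [hsum, Nat.cast_sum, Finset.mul_sum]
  linarith [phasePos_sub_phaseNonneg U B]

end UnitaryFamily

theorem theorem2p1 {V : Type*} [NormedAddCommGroup V] [InnerProductSpace ℂ V]
    [FiniteDimensional ℂ V] (U : ℝ → V ≃ₗᵢ[ℂ] V)
    (hU : UnitaryFamily.IsAnalytic U) (hmono : UnitaryFamily.IsMonotone U) :
    IsDiscrete (UnitaryFamily.Z U) ∧
    ∀ A B : ℝ, A < B →
      (UnitaryFamily.Z U ∩ Set.Ioo A B).Finite ∧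
      (¬ (U A = 1 ∧ U B = 1) →
        ‖((∑ᶠ x ∈ Set.Ioo A B, Module.finrank ℂ (UnitaryFamily.W U x) : ℕ) : ℂ)
          - 1 / (2 * (Real.pi : ℂ)) *
            ∫ x in A..B, LinearMap.trace ℂ V (UnitaryFamily.D U x).toLinearMap‖
          < (Module.finrank ℂ V : ℝ)) ∧
      ‖((∑ᶠ x ∈ Set.Ioo A B, Module.finrank ℂ (UnitaryFamily.W U x) : ℕ) : ℂ)
          - 1 / (2 * (Real.pi : ℂ)) *
            ∫ x in A..B, LinearMap.trace ℂ V (UnitaryFamily.D U x).toLinearMap‖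
          ≤ (Module.finrank ℂ V : ℝ) := by
  open UnitaryFamily in
  refine ⟨isDiscrete_Z hU hmono, fun A B hAB => ?_⟩
  have hpi := Real.two_pi_pos
  have hformula : ‖((∑ᶠ x ∈ Set.Ioo A B, Module.finrank ℂ (W U x) : ℕ) : ℂ)
      - 1 / (2 * (Real.pi : ℂ)) * ∫ x in A..B, LinearMap.trace ℂ V (D U x).toLinearMap‖ =
      |phaseNonneg U A - phasePos U B| / (2 * Real.pi) := by
    have h : ((∑ᶠ x ∈ Set.Ioo A B, Module.finrank ℂ (W U x) : ℕ) : ℝ) -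
        1 / (2 * Real.pi) * totalPhase U A B =
          (phaseNonneg U A - phasePos U B) / (2 * Real.pi) := by
      have := finsum_finrank_W hU hmono hAB
      field_simp
      linarith
    have habs : |phaseNonneg U A - phasePos U B| / (2 * Real.pi) =
        |(phaseNonneg U A - phasePos U B) / (2 * Real.pi)| := by rw [abs_div, abs_of_pos hpi]
    rw [← ofReal_totalPhase hU, habs, ← h, ← Real.norm_eq_abs, ← Complex.norm_real]
    push_cast
    rfl
  have hA := phasePos_sub_phaseNonneg U A
  have hA0 : 0 ≤ 2 * Real.pi * Module.finrank ℂ (W U A) := by positivity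
  have hA1 := phasePos_le U A
  have hA2 := phaseNonneg_nonneg U A
  have hB1 := phasePos_le U B
  have hB2 := phasePos_nonneg U B
  refine ⟨(finite_inter_Icc_of_eventually_notMem (eventually_notMem_Z hU hmono) A B).subset
    (Set.inter_subset_inter_right _ Set.Ioo_subset_Icc_self), fun hne => ?_, ?_⟩
  · rw [hformula, div_lt_iff₀ hpi, mul_comm, abs_lt]
    -- On the zero space every operator is the identity, so M = 0 falls under the exceptional case.
    have : Nontrivial V := by
      by_contra h
      rw [not_nontrivial_iff_subsingleton] at h
      exact hne ⟨by ext v; exact Subsingleton.elim _ _, by ext v; exact Subsingleton.elim _ _⟩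
    have hB3 := phasePos_pos U B
    refine ⟨?_, by linarith⟩
    -- Reaching −2πM needs `phaseNonneg U A` = 0 and `phasePos U B` = 2πM at once.
    by_contra hcon
    exact hne ⟨eq_one_of_phaseNonneg_eq (by linarith), eq_one_of_phasePos_eq (by linarith)⟩
  · rw [hformula, div_le_iff₀ hpi, mul_comm, abs_le]
    exact ⟨by linarith, by linarith⟩
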